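/- **Setting.** Let $g_1,\dots,g_m\in\mathbb{R}[\mathbf{x}]=\mathbb{R}[x_1,\dots,x_n]$ be nonzero polynomials such that $S=\{\mathbf{x}\in\mathbb{R}^n: g_j(\mathbf{x})\ge 0,\ j=1,\dots,m\}$ has nonempty interior. Put $g_0=1$, $G=\{g_0,g_1,\dots,g_m\}$, $t_g=\lceil\deg(g)/2\rceil$, $G_t=\{g\in G: t_g\le t\}$ and $s(d)=\binom{n+d}{n}$. Let $\mathbb{N}^n_d=\{\alpha\in\mathbb{N}^n:|\alpha|\le d\}$ and $\mathbf{v}_d(\mathbf{x})=(\mathbf{x}^\alpha)_{\alpha\in\mathbb{N}^n_d}$. Let $$Q_t(G)=\Big\{\sum_{g\in G}\sigma_g\,g:\ \sigma_g\in\mathbb{R}[\mathbf{x}]\text{ a sum of squares},\ \deg(\sigma_g g)\le 2t\Big\}\subset\mathbb{R}[\mathbf{x}]_{2t},$$ where $\mathbb{R}[\mathbf{x}]_{2t}$ is the finite-dimensional space of polynomials of degree at most $2t$, in which interiors are taken. For a vector $\boldsymbol{\phi}=(\phi_\alpha)_{|\alpha|\le 2t}$ let $\phi(p)=\sum_\alpha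 p_\alpha\phi_\alpha$ for $p\in\mathbb{R}[\mathbf{x}]_{2t}$, and for $g\in G_t$ let $\mathbf{M}_{t-t_g}(g\cdot\boldsymbol{\phi})$ be the matrix with entries $\sum_\gamma g_\gamma\,\phi_{\alpha+\beta+\gamma}$, $\alpha,\beta\in\mathbb{N}^n_{t-t_g}$. When this matrix is positive definite, let $\Lambda^{g\cdot\phi}_{t-t_g}$ be the Christoffel function defined by $$\Lambda^{g\cdot\phi}_{t-t_g}(\mathbf{x})^{-1}=\mathbf{v}_{t-t_g}(\mathbf{x})^T\,\mathbf{M}_{t-t_g}(g\cdot\boldsymbol{\phi})^{-1}\,\mathbf{v}_{t-t_g}(\mathbf{x}).$$ With the convention $\log\det A=-\infty$ for $A\succeq 0$ singular, consider the primal problem $$\rho_t=\inf_{\boldsymbol{\phi}}\Big\{-\sum_{g\in G_t}\log\det \mathbf{M}_{t-t_g}(g\cdot\boldsymbol{\phi}):\ \phi(1)=1,\ \mathbf{M}_{t-t_g}(g\cdot\boldsymbol{\phi})\succeq 0\ \ \forall g\in G_t\Big\}$$ over vectors $\boldsymbol{\phi}=(\phi_\alpha)_{|\alpha|\le 2t}$,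 and the dual problem $$\rho_t^*=\sup_{(\mathbf{Q}_g)}\Big\{\sum_{g\in G_t}\log\det \mathbf{Q}_g:\ \mathbf{Q}_g\succeq 0\ \ \forall g\in G_t,\ \sum_{g\in G_t}s(t-t_g)=\sum_{g\in G_t}g(\mathbf{x})\,\mathbf{v}_{t-t_g}(\mathbf{x})^T\mathbf{Q}_g\,\mathbf{v}_{t-t_g}(\mathbf{x})\ \ \forall\mathbf{x}\in\mathbb{R}^n\Big\}$$ over families $(\mathbf{Q}_g)_{g\in G_t}$ of real symmetric matrices $\mathbf{Q}_g$ indexed by $\mathbb{N}^n_{t-t_g}$. An infeasible problem has value $\rho_t=+\infty$, respectively $\rho^*_t=-\infty$. **Theorem.** Fix $t\in\mathbb{N}$. The two problems have the same finite optimal value $\rho_t=\rho_t^*\in\mathbb{R}$ if and only if $1\in\operatorname{int}(Q_t(G))$. In that case, each of the two problems has a unique optimal solution, $\boldsymbol{\phi}^*_{2t}$ and $(\mathbf{Q}^*_g)_{g\in G_t}$ respectively. The matrices $\mathbf{M}_{t-t_g}(g\cdot\boldsymbol{\phi}^*_{2t})$, $g\in G_t$, are positive definite, and $\mathbf{Q}_g^*=\mathbf{M}_{t-t_g}(g\cdot\boldsymbol{\phi}^*_{2t})^{-1}$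 for all $g\in G_t$. Consequently, for all $\mathbf{x}\in\mathbb{R}^n$, $$1=\frac{1}{\sum_{g\in G_t}s(t-t_g)}\sum_{g\in G_t}g(\mathbf{x})\,\mathbf{v}_{t-t_g}(\mathbf{x})^T\mathbf{M}_{t-t_g}(g\cdot\boldsymbol{\phi}^*_{2t})^{-1}\mathbf{v}_{t-t_g}(\mathbf{x}),$$ that is, $\displaystyle\sum_{g\in G_t}s(t-t_g)=\sum_{g\in G_t}g(\mathbf{x})\,\Lambda^{g\cdot\phi^*_{2t}}_{t-t_g}(\mathbf{x})^{-1}$. -/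

import Mathlib

namespace Pell

open MvPolynomial

/-- The set `ℕⁿ_d` of exponents `α ∈ ℕⁿ` with `|α| ≤ d`. -/
def expo (n d : ℕ) : Finset (Fin n →₀ ℕ) :=
  (Finset.range (d + 1)).biUnion fun k => Finset.finsuppAntidiag Finset.univ k

theorem mem_expo {n d : ℕ} {α : Fin n →₀ ℕ} : α ∈ expo n d ↔ ∑ i, α i ≤ d := by
  simp [expo, Finset.mem_finsuppAntidiag]

/-- `s(d) = binom(n+d, n)`. -/
def s (n d : ℕ) : ℕ := (n + d).choose n

/-- The vector of monomials `v_d(x) = (x^α)_{|α| ≤ d}`. -/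
def monomialVec {n : ℕ} (d : ℕ) (x : Fin n → ℝ) : expo n d → ℝ :=
  fun α => ∏ i, x i ^ α.1 i

/-- The set `S = {x ∈ ℝⁿ : g_j(x) ≥ 0, j = 1, …, m}`. -/
def basicSet {n m : ℕ} (g : Fin m → MvPolynomial (Fin n) ℝ) : Set (Fin n → ℝ) :=
  {x | ∀ j, 0 ≤ eval x (g j)}

open Classical in
/-- The set of generators `G = {g_0, g_1, …, g_m}`, with `g_0 = 1`. -/
noncomputable def gens {n m : ℕ} (g : Fin m → MvPolynomial (Fin n) ℝ) :
    Finset (MvPolynomial (Fin n) ℝ) :=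
  insert 1 (Finset.univ.image g)

/-- `t_g = ⌈deg(g) / 2⌉`. -/
noncomputable def halfDeg {n : ℕ} (g : MvPolynomial (Fin n) ℝ) : ℕ := (g.totalDegree + 1) / 2

/-- `G_t = {g ∈ G : t_g ≤ t}`. -/
noncomputable def trunc {n : ℕ} (G : Finset (MvPolynomial (Fin n) ℝ)) (t : ℕ) :
    Finset (MvPolynomial (Fin n) ℝ) :=
  G.filter fun g => halfDeg g ≤ t

/-- The truncated quadratic module
`Q_t(G) = {∑_{g ∈ G} σ_g g : σ_g sum of squares, deg(σ_g g) ≤ 2t}`. -/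
def quadModule {n : ℕ} (G : Finset (MvPolynomial (Fin n) ℝ)) (t : ℕ) :
    Set (MvPolynomial (Fin n) ℝ) :=
  {p | ∃ σ : MvPolynomial (Fin n) ℝ → MvPolynomial (Fin n) ℝ,
    (∀ g ∈ G, IsSumSq (σ g) ∧ (σ g * g).totalDegree ≤ 2 * t) ∧ p = ∑ g ∈ G, σ g * g}

/-- The coefficient vector of a polynomial up to degree `d`; it identifies `ℝ[x]_d` with
the Euclidean space of functions on `ℕⁿ_d`. -/
noncomputable def coeffVec {n : ℕ} (d : ℕ) (p : MvPolynomial (Fin n) ℝ) : expo n d → ℝ :=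
  fun α => coeff α.1 p

/-- `1 ∈ int(Q_t(G))`, the interior being taken in the finite-dimensional space `ℝ[x]_{2t}`
(in coefficient coordinates). -/
def OneMemInterior {n : ℕ} (G : Finset (MvPolynomial (Fin n) ℝ)) (t : ℕ) : Prop :=
  coeffVec (2 * t) (1 : MvPolynomial (Fin n) ℝ) ∈ interior (coeffVec (2 * t) '' quadModule G t)

/-- A finite vector `(φ_α)_{|α| ≤ d}`, completed by zeros to a sequence on `ℕⁿ`. -/
noncomputable def extend {n d : ℕ} (φ : expo n d → ℝ) : (Fin n →₀ ℕ) → ℝ :=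
  fun α => if h : α ∈ expo n d then φ ⟨α, h⟩ else 0

/-- The Riesz functional of a sequence, `p ↦ ∑_α p_α y_α`. -/
noncomputable def riesz {n : ℕ} (y : (Fin n →₀ ℕ) → ℝ) (p : MvPolynomial (Fin n) ℝ) : ℝ :=
  ∑ α ∈ p.support, coeff α p * y α

/-- The sequence `g · y = (∑_γ g_γ y_{α+γ})_α`. -/
noncomputable def mulSeq {n : ℕ} (g : MvPolynomial (Fin n) ℝ) (y : (Fin n →₀ ℕ) → ℝ) :
    (Fin n →₀ ℕ) → ℝ :=
  fun α => ∑ γ ∈ g.support, coeff γ g * y (α + γ)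

/-- The moment matrix `M_d(y)(α, β) = y_{α+β}`, `|α|, |β| ≤ d`. -/
noncomputable def momentMatrix {n : ℕ} (d : ℕ) (y : (Fin n →₀ ℕ) → ℝ) : Matrix (expo n d) (expo n d) ℝ :=
  Matrix.of fun α β => y (α.1 + β.1)

/-- The localizing matrix `M_{t-t_g}(g · φ)` of a vector `φ = (φ_α)_{|α| ≤ 2t}`. For `t_g ≤ t` it
only involves entries `φ_α` with `|α| ≤ 2t`. -/
noncomputable def locMatrix {n t : ℕ} (φ : expo n (2 * t) → ℝ) (g : MvPolynomial (Fin n) ℝ) :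
    Matrix (expo n (t - halfDeg g)) (expo n (t - halfDeg g)) ℝ :=
  momentMatrix (t - halfDeg g) (mulSeq g (extend φ))

/-- The quadratic form `v_d(x)ᵀ Q v_d(x)`. -/
def gramForm {n d : ℕ} (Q : Matrix (expo n d) (expo n d) ℝ) (x : Fin n → ℝ) : ℝ :=
  monomialVec d x ⬝ᵥ (Q.mulVec (monomialVec d x))

/-- The Christoffel function `Λ_d^y(x) = (v_d(x)ᵀ M_d(y)⁻¹ v_d(x))⁻¹`, meant for sequences with
`M_d(y)` positive definite. -/
noncomputable def christoffel {n : ℕ} (d : ℕ) (y : (Fin n →₀ ℕ) → ℝ) (x : Fin n → ℝ) : ℝ :=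
  (gramForm (momentMatrix d y)⁻¹ x)⁻¹

open Classical in
/-- `log det A ∈ ℝ ∪ {-∞}`, with the value `-∞` unless `A` is positive definite. -/
noncomputable def logDet {ι : Type*} [Fintype ι] [DecidableEq ι] (A : Matrix ι ι ℝ) : EReal :=
  if A.PosDef then ((Real.log A.det : ℝ) : EReal) else ⊥

/-- Feasibility in the primal problem: `φ(1) = 1` and `M_{t-t_g}(g · φ) ⪰ 0` for `g ∈ G_t`. -/
def PrimalFeasible {n : ℕ} (G : Finset (MvPolynomial (Fin n) ℝ)) (t : ℕ)
    (φ : expo n (2 * t) → ℝ) : Prop :=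
  riesz (extend φ) 1 = 1 ∧ ∀ g ∈ trunc G t, (locMatrix φ g).PosSemidef

/-- The primal criterion `-∑_{g ∈ G_t} log det M_{t-t_g}(g · φ)`. -/
noncomputable def primalObj {n : ℕ} (G : Finset (MvPolynomial (Fin n) ℝ)) (t : ℕ)
    (φ : expo n (2 * t) → ℝ) : EReal :=
  -∑ g ∈ trunc G t, logDet (locMatrix φ g)

/-- The primal optimal value `ρ_t` (`+∞` for an infeasible problem). -/
noncomputable def primalValue {n : ℕ} (G : Finset (MvPolynomial (Fin n) ℝ)) (t : ℕ) : EReal :=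
  ⨅ (φ : expo n (2 * t) → ℝ) (_ : PrimalFeasible G t φ), primalObj G t φ

/-- `φ` is an optimal solution of the primal problem. -/
def PrimalOptimal {n : ℕ} (G : Finset (MvPolynomial (Fin n) ℝ)) (t : ℕ)
    (φ : expo n (2 * t) → ℝ) : Prop :=
  PrimalFeasible G t φ ∧ primalObj G t φ = primalValue G t

/-- Families `(Q_g)_{g ∈ G_t}` of real matrices, `Q_g` being indexed by `ℕⁿ_{t-t_g}`. -/
abbrev GramFamily {n : ℕ} (G : Finset (MvPolynomial (Fin n) ℝ)) (t : ℕ) : Type :=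
  (g : trunc G t) → Matrix (expo n (t - halfDeg g.1)) (expo n (t - halfDeg g.1)) ℝ

/-- The number `∑_{g ∈ G_t} s(t - t_g)`. -/
noncomputable def totalSize {n : ℕ} (G : Finset (MvPolynomial (Fin n) ℝ)) (t : ℕ) : ℝ :=
  ∑ g ∈ trunc G t, (s n (t - halfDeg g) : ℝ)

/-- Feasibility in the dual problem: `Q_g ⪰ 0` (symmetric) for `g ∈ G_t`, and
`∑_{g ∈ G_t} s(t-t_g) = ∑_{g ∈ G_t} g(x) v_{t-t_g}(x)ᵀ Q_g v_{t-t_g}(x)` for all `x ∈ ℝⁿ`. -/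
def DualFeasible {n : ℕ} (G : Finset (MvPolynomial (Fin n) ℝ)) (t : ℕ)
    (Q : GramFamily G t) : Prop :=
  (∀ g, (Q g).PosSemidef) ∧
    ∀ x : Fin n → ℝ, totalSize G t = ∑ g : trunc G t, eval x g.1 * gramForm (Q g) x

/-- The dual criterion `∑_{g ∈ G_t} log det Q_g`. -/
noncomputable def dualObj {n : ℕ} (G : Finset (MvPolynomial (Fin n) ℝ)) (t : ℕ)
    (Q : GramFamily G t) : EReal :=
  ∑ g : trunc G t, logDet (Q g)

/-- The dual optimal value `ρ_t^*` (`-∞` for an infeasible problem). -/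
noncomputable def dualValue {n : ℕ} (G : Finset (MvPolynomial (Fin n) ℝ)) (t : ℕ) : EReal :=
  ⨆ (Q : GramFamily G t) (_ : DualFeasible G t Q), dualObj G t Q

/-- `Q` is an optimal solution of the dual problem. -/
def DualOptimal {n : ℕ} (G : Finset (MvPolynomial (Fin n) ℝ)) (t : ℕ)
    (Q : GramFamily G t) : Prop :=
  DualFeasible G t Q ∧ dualObj G t Q = dualValue G t

end Pell

open Pell

/-! Applying the Riesz functional of a primal feasible `φ` to the dual identity gives `∑ tr (M_g
Q_g) = N`, where `N` is the total size of the blocks. For positive definite `A`, `B` of size `k`,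
`log det A + log det B ≤ tr (A B) - k`, with equality only if `B = A⁻¹`
(`Matrix.PosDef.log_det_add_log_det`). Summing over the blocks yields weak duality, and shows that
values agree only when `Q_g = M_g⁻¹` for all `g`. Hence one primal point whose inverse localizing
matrices are dual feasible solves both problems, uniquely.

Such a point exists when `1` is interior. For small `r > 0` the polynomial `1 - r ∑ x^(2α)` lies in
the quadratic module, so `tr M_t(φ) ≤ 1/r` and the primal feasible set is compact. Averaging Dirac
masses over a grid inside `S` gives a strictly feasible point, so the maximum of `∏ det M_g` is
positive and its maximizer has positive definite blocks. There the derivative vanishes in every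
direction `ψ` with `ψ(1) = 0`; the direction `δ_x - φ` gives exactly the dual identity at `x`. No
separation theorem is needed.

Conversely, a dual value above `-∞` provides a dual feasible family of positive definite blocks.
Perturbing the block of `g = 1` alone reaches all polynomials of degree at most `2t` near `1`. -/

namespace Matrix

/-! ### Positive definite matrices: trace pairing, log-determinant inequality, derivative of the
determinant. -/

variable {ι : Type*} [Fintype ι]

/-- Positive definiteness is an open condition on symmetric matrices. -/
theorem eventually_posDef {X : Type*} [TopologicalSpace X] {f : X → Matrix ι ι ℝ} {x₀ : X}
    (hf : Continuous f) (hsymm : ∀ x, (f x).IsHermitian) (h₀ : (f x₀).PosDef) :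
    ∀ᶠ x in nhds x₀, (f x).PosDef := by
  classical
  have hK : IsCompact (Metric.sphere (0 : ι → ℝ) 1) := isCompact_sphere _ _
  have hcont : Continuous fun p : X × (ι → ℝ) => p.2 ⬝ᵥ (f p.1 *ᵥ p.2) :=
    continuous_snd.dotProduct ((hf.comp continuous_fst).matrix_mulVec continuous_snd)
  have key : ∀ᶠ x in nhds x₀, ∀ u ∈ Metric.sphere (0 : ι → ℝ) 1, 0 < u ⬝ᵥ (f x *ᵥ u) := by
    refine hK.eventually_forall_of_forall_eventually fun u hu => ?_
    have hu0 : u ≠ 0 := by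
      rintro rfl
      simp at hu
    have := h₀.dotProduct_mulVec_pos hu0
    exact hcont.continuousAt.eventually (lt_mem_nhds (by simpa using this))
  filter_upwards [key] with x hx
  refine PosDef.of_dotProduct_mulVec_pos (hsymm x) fun u hu => ?_
  have hn : 0 < ‖u‖ := norm_pos_iff.2 hu
  have := hx (‖u‖⁻¹ • u) (by simp [norm_smul, hn.ne'])
  rw [mulVec_smul, dotProduct_smul, smul_dotProduct, smul_eq_mul, smul_eq_mul] at this
  have h2 : 0 < ‖u‖⁻¹ := inv_pos.2 hn
  simpa using (pos_of_mul_pos_right (pos_of_mul_pos_right this h2.le) h2.le)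

theorem isClosed_setOf_posSemidef : IsClosed {A : Matrix ι ι ℝ | A.PosSemidef} := by
  simp only [posSemidef_iff_dotProduct_mulVec, IsHermitian, Set.ofPred_and, Set.ofPred_forall]
  refine (isClosed_eq continuous_id.matrix_conjTranspose continuous_id).inter
    (isClosed_iInter fun u => isClosed_le continuous_const ?_)
  exact continuous_const.dotProduct (continuous_id.matrix_mulVec continuous_const)

theorem PosSemidef.trace_mul_nonneg {A B : Matrix ι ι ℝ} (hA : A.PosSemidef) (hB : B.PosSemidef) :
    0 ≤ (A * B).trace := by
  obtain ⟨m, v, rfl⟩ := posSemidef_iff_eq_sum_vecMulVec.1 hB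
  rw [Matrix.mul_sum, trace_sum]
  refine Finset.sum_nonneg fun i _ => ?_
  rw [mul_vecMulVec, trace_vecMulVec, dotProduct_comm]
  exact hA.dotProduct_mulVec_nonneg (v i)

variable [DecidableEq ι]

/-- Sum `log λ ≤ λ - 1` over the eigenvalues; strictness for `λ ≠ 1` gives the equality case that
follows. -/
theorem PosDef.log_det_le {P : Matrix ι ι ℝ} (hP : P.PosDef) :
    Real.log P.det ≤ P.trace - Fintype.card ι := by
  have hpos := hP.eigenvalues_pos
  rw [hP.1.det_eq_prod_eigenvalues, hP.1.trace_eq_sum_eigenvalues]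
  simp only [RCLike.ofReal_real_eq_id, id]
  rw [Real.log_prod fun i _ => (hpos i).ne']
  calc _ ≤ ∑ i, (hP.1.eigenvalues i - 1) :=
        Finset.sum_le_sum fun i _ => Real.log_le_sub_one_of_pos (hpos i)
    _ = _ := by simp

theorem PosDef.eq_one_of_log_det_eq {P : Matrix ι ι ℝ} (hP : P.PosDef)
    (h : Real.log P.det = P.trace - Fintype.card ι) : P = 1 := by
  have hpos := hP.eigenvalues_pos
  rw [hP.1.det_eq_prod_eigenvalues, hP.1.trace_eq_sum_eigenvalues] at h
  simp only [RCLike.ofReal_real_eq_id, id] at h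
  rw [Real.log_prod fun i _ => (hpos i).ne'] at h
  have h' : ∑ i, Real.log (hP.1.eigenvalues i) = ∑ i, (hP.1.eigenvalues i - 1) := by simp [h]
  rw [Finset.sum_eq_sum_iff_of_le fun i _ => Real.log_le_sub_one_of_pos (hpos i)] at h'
  have h1 : hP.1.eigenvalues = 1 := by
    funext i
    by_contra hne
    exact (Real.log_lt_sub_one_of_pos (hpos i) hne).ne (h' i (Finset.mem_univ i))
  rw [hP.1.spectral_theorem, h1]
  have : diagonal ((RCLike.ofReal : ℝ → ℝ) ∘ (1 : ι → ℝ)) = 1 := by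
    ext i j; simp [diagonal, one_apply]
  rw [this, map_one]

theorem PosDef.exists_isUnit_conjTranspose_mul {A : Matrix ι ι ℝ} (hA : A.PosDef) :
    ∃ B : Matrix ι ι ℝ, IsUnit B ∧ A = Bᴴ * B := by
  open scoped MatrixOrder in
  obtain ⟨B, hB⟩ := CStarAlgebra.nonneg_iff_eq_star_mul_self.1 hA.posSemidef.nonneg
  refine ⟨B, ?_, hB⟩
  have h := hA.isUnit
  rw [hB, isUnit_iff_isUnit_det, det_mul, IsUnit.mul_iff] at h
  exact (isUnit_iff_isUnit_det B).2 h.2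

/-- With `A = Cᴴ C`, the positive definite matrix `C B Cᴴ` has the determinant and trace of `A B`,
which reduces everything to one matrix; equality forces `C B Cᴴ = 1`. -/
theorem PosDef.log_det_add_log_det {A B : Matrix ι ι ℝ} (hA : A.PosDef) (hB : B.PosDef) :
    Real.log A.det + Real.log B.det ≤ (A * B).trace - Fintype.card ι ∧
      (Real.log A.det + Real.log B.det = (A * B).trace - Fintype.card ι → B = A⁻¹) := by
  obtain ⟨C, hC, rfl⟩ := hA.exists_isUnit_conjTranspose_mul
  have hP : (C * B * Cᴴ).PosDef := by
    have := (IsUnit.posDef_star_right_conjugate_iff (x := B) hC).2 hB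
    simpa [star_eq_conjTranspose] using this
  have hdet : Real.log (Cᴴ * C).det + Real.log B.det = Real.log (C * B * Cᴴ).det := by
    rw [← Real.log_mul hA.det_pos.ne' hB.det_pos.ne']
    simp only [det_mul]
    ring_nf
  have htr : (Cᴴ * C * B).trace = (C * B * Cᴴ).trace := by
    rw [Matrix.mul_assoc, trace_mul_comm]
  rw [hdet, htr]
  refine ⟨hP.log_det_le, fun h => ?_⟩
  have h1 := hP.eq_one_of_log_det_eq h
  symm
  refine inv_eq_left_inv ?_
  have h2 : C * (B * Cᴴ) = 1 := by rw [← Matrix.mul_assoc, h1]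
  rw [← Matrix.mul_assoc]
  exact mul_eq_one_comm.1 h2

/-- Factor out `det A` and expand `det (1 + r A⁻¹ E)` to first order; the remainder is `r²` times a
polynomial in `r`. -/
theorem hasDerivAt_det_add_smul {A : Matrix ι ι ℝ} (hA : A.PosDef) (E : Matrix ι ι ℝ) :
    HasDerivAt (fun r : ℝ => (A + r • E).det) (A.det * (A⁻¹ * E).trace) 0 := by
  set q := (det (1 + (Polynomial.X : Polynomial ℝ) • (A⁻¹ * E).map Polynomial.C)).divX.divX
  have h : (fun r : ℝ => (A + r • E).det) = fun r =>
      A.det * (1 + (A⁻¹ * E).trace * r + q.eval r * r ^ 2) := by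
    funext r
    rw [← det_one_add_smul, ← det_mul, Matrix.mul_add, Matrix.mul_one, Matrix.mul_smul,
      ← Matrix.mul_assoc, mul_nonsing_inv _ ((isUnit_iff_isUnit_det A).1 hA.isUnit), Matrix.one_mul]
  rw [h]
  have h1 := (((hasDerivAt_id (0 : ℝ)).const_mul (A⁻¹ * E).trace).const_add 1).add
    ((q.hasDerivAt 0).mul ((hasDerivAt_id (0 : ℝ)).pow 2))
  have h2 := h1.const_mul A.det
  exact h2.congr_deriv (by simp)

end Matrix

/-! ### Leading terms of sums of squares. -/

namespace MvPolynomial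

open MonomialOrder

/-- Nonnegative leading coefficients cannot cancel. This bounds the degree of each square by that of
the whole sum. -/
theorem leadingCoeff_add_nonneg {n : ℕ} {p q : MvPolynomial (Fin n) ℝ}
    (hp : 0 ≤ degLex.leadingCoeff p) (hq : 0 ≤ degLex.leadingCoeff q) :
    0 ≤ degLex.leadingCoeff (p + q) ∧ p.totalDegree ≤ (p + q).totalDegree := by
  rcases lt_trichotomy (degLex.toSyn (degLex.degree p)) (degLex.toSyn (degLex.degree q))
    with h | h | h
  · rw [add_comm, degLex.leadingCoeff_add_of_lt h]
    refine ⟨hq, degLex_totalDegree_monotone ?_⟩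
    rw [degLex.degree_add_of_lt h]
    exact h.le
  · have h' := degLex.toSyn.injective h
    by_cases h0 : degLex.leadingCoeff p + degLex.leadingCoeff q = 0
    · have hp0 : p = 0 := degLex.leadingCoeff_eq_zero_iff.1 (by linarith)
      have hq0 : q = 0 := degLex.leadingCoeff_eq_zero_iff.1 (by linarith)
      simp [hp0, hq0]
    · have hc : coeff (degLex.degree p) (p + q) =
          degLex.leadingCoeff p + degLex.leadingCoeff q := by
        rw [coeff_add, MonomialOrder.leadingCoeff, MonomialOrder.leadingCoeff, ← h']
      have hle := degLex.le_degree (mem_support_iff.2 (hc ▸ h0))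
      refine ⟨?_, degLex_totalDegree_monotone hle⟩
      have hge : degLex.toSyn (degLex.degree (p + q)) ≤ degLex.toSyn (degLex.degree p) :=
        degLex.degree_add_le.trans (by rw [h, max_self])
      have heq := degLex.toSyn.injective (le_antisymm hge hle)
      rw [MonomialOrder.leadingCoeff, heq, hc]
      exact add_nonneg hp hq
  · rw [degLex.leadingCoeff_add_of_lt h]
    refine ⟨hp, degLex_totalDegree_monotone ?_⟩
    rw [degLex.degree_add_of_lt h]

theorem leadingCoeff_mul_self_nonneg {n : ℕ} (a : MvPolynomial (Fin n) ℝ) :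
    0 ≤ degLex.leadingCoeff (a * a) := by
  rw [degLex.leadingCoeff_mul]
  exact mul_self_nonneg _

theorem leadingCoeff_nonneg_of_isSumSq {n : ℕ} {σ : MvPolynomial (Fin n) ℝ} (h : IsSumSq σ) :
    0 ≤ degLex.leadingCoeff σ := by
  induction h with
  | zero => simp
  | sq_add a _ ih => exact (leadingCoeff_add_nonneg (leadingCoeff_mul_self_nonneg a) ih).1

end MvPolynomial

/-! ### Monomials, Riesz functionals, moment matrices and Gram matrices. -/

namespace Pell

open MvPolynomial

variable {n : ℕ}

theorem sum_id_eq_sum {α : Fin n →₀ ℕ} : (α.sum fun _ e => e) = ∑ i, α i :=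
  Finsupp.sum_fintype _ _ fun _ => rfl

/-- Count each degree by stars and bars, then add up with Pascal's rule. -/
theorem card_expo (n d : ℕ) : Fintype.card (expo n d) = s n d := by
  rw [Fintype.card_coe, expo, Finset.card_biUnion]
  · simp only [Finset.card_finsuppAntidiag_nat_eq_choose, Finset.card_univ, Fintype.card_fin, s]
    induction d with
    | zero => simp
    | succ d ih =>
      rw [Finset.sum_range_succ, ih]
      have h1 : n + (d + 1) - 1 = n + d := by omega
      have h2 : (n + d).choose n = (n + d).choose d := Nat.choose_symm_add
      have h3 : (n + (d + 1)).choose n = (n + (d + 1)).choose (d + 1) := Nat.choose_symm_add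
      rw [h1, h2, h3, ← add_assoc, Nat.choose_succ_succ]
  · intro i _ j _ hij
    refine Finset.disjoint_left.2 fun α hi hj => ?_
    rw [Finset.mem_finsuppAntidiag] at hi hj
    exact hij (hi.1.symm.trans hj.1)

theorem mem_expo_of_mem_support {d : ℕ} {p : MvPolynomial (Fin n) ℝ} (hp : p.totalDegree ≤ d)
    {α : Fin n →₀ ℕ} (hα : α ∈ p.support) : α ∈ expo n d := by
  rw [mem_expo, ← sum_id_eq_sum]
  exact (le_totalDegree hα).trans hp

theorem totalDegree_monomial_le_of_mem {d : ℕ} {α : Fin n →₀ ℕ} (hα : α ∈ expo n d) (c : ℝ) :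
    (monomial α c).totalDegree ≤ d := by
  refine (totalDegree_monomial_le _ _).trans ?_
  rw [mem_expo] at hα
  exact (sum_id_eq_sum (α := α)).trans_le hα

theorem add_mem_expo {d e : ℕ} {α β : Fin n →₀ ℕ} (hα : α ∈ expo n d) (hβ : β ∈ expo n e) :
    α + β ∈ expo n (d + e) := by
  rw [mem_expo] at *
  simp only [Finsupp.add_apply, Finset.sum_add_distrib]
  omega

/-- The Riesz functional as a linear map. -/
noncomputable def rieszLin (y : (Fin n →₀ ℕ) → ℝ) : MvPolynomial (Fin n) ℝ →ₗ[ℝ] ℝ :=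
  (basisMonomials (Fin n) ℝ).constr ℝ y

@[simp] theorem rieszLin_monomial (y : (Fin n →₀ ℕ) → ℝ) (α : Fin n →₀ ℕ) (c : ℝ) :
    rieszLin y (monomial α c) = c * y α := by
  have h : rieszLin y (monomial α 1) = y α := by
    have := (basisMonomials (Fin n) ℝ).constr_basis ℝ y α
    rwa [coe_basisMonomials] at this
  rw [← mul_one c, ← smul_eq_mul, ← smul_monomial, map_smul, h, smul_eq_mul, smul_eq_mul, mul_one]

theorem rieszLin_apply (y : (Fin n →₀ ℕ) → ℝ) (p : MvPolynomial (Fin n) ℝ) :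
    rieszLin y p = riesz y p := by
  conv_lhs => rw [p.as_sum]
  simp only [map_sum, rieszLin_monomial, riesz]

theorem mulSeq_eq (g : MvPolynomial (Fin n) ℝ) (y : (Fin n →₀ ℕ) → ℝ) (α : Fin n →₀ ℕ) :
    mulSeq g y α = rieszLin y (g * monomial α 1) := by
  conv_rhs => rw [g.as_sum, Finset.sum_mul]
  simp [mulSeq, monomial_mul, add_comm]

theorem rieszLin_extend {d : ℕ} (φ : expo n d → ℝ) (p : MvPolynomial (Fin n) ℝ) :
    rieszLin (extend φ) p = ∑ α : expo n d, coeff α.1 p * φ α := by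
  have h : ∀ α : expo n d, φ α = extend φ α.1 := fun α => by simp [extend]
  simp only [h]
  rw [Finset.sum_coe_sort (expo n d) fun α => coeff α p * extend φ α, rieszLin_apply, riesz]
  rw [Finset.sum_subset (Finset.subset_union_left (s₁ := p.support) (s₂ := expo n d))
    fun α _ h => by simp [notMem_support_iff.1 h]]
  symm
  refine Finset.sum_subset Finset.subset_union_right fun α _ h => ?_
  simp [extend, h]

theorem rieszLin_extend_of_totalDegree_le {d : ℕ} (y : (Fin n →₀ ℕ) → ℝ)
    {p : MvPolynomial (Fin n) ℝ} (hp : p.totalDegree ≤ d) :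
    rieszLin (extend fun α : expo n d => y α.1) p = rieszLin y p := by
  rw [rieszLin_apply, rieszLin_apply, riesz, riesz]
  refine Finset.sum_congr rfl fun α hα => ?_
  rw [extend, dif_pos (mem_expo_of_mem_support hp hα)]

theorem rieszLin_eval (x : Fin n → ℝ) (p : MvPolynomial (Fin n) ℝ) :
    rieszLin (fun α => ∏ i, x i ^ α i) p = eval x p := by
  rw [rieszLin_apply, riesz, eval_eq']

/-- The truncated moment vector of the Dirac measure at `x`. -/
def dirac (d : ℕ) (x : Fin n → ℝ) : expo n d → ℝ := fun α => ∏ i, x i ^ α.1 i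

theorem rieszLin_dirac {d : ℕ} (x : Fin n → ℝ) {p : MvPolynomial (Fin n) ℝ}
    (hp : p.totalDegree ≤ d) : rieszLin (extend (dirac d x)) p = eval x p :=
  (rieszLin_extend_of_totalDegree_le (fun α => ∏ i, x i ^ α i) hp).trans (rieszLin_eval x p)

/-- The polynomial with coefficient vector `u`. -/
noncomputable def vecPoly {d : ℕ} (u : expo n d → ℝ) : MvPolynomial (Fin n) ℝ :=
  ∑ α, monomial α.1 (u α)

theorem coeff_vecPoly {d : ℕ} (u : expo n d → ℝ) (α : expo n d) :
    coeff α.1 (vecPoly u) = u α := by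
  classical
  simp [vecPoly, coeff_sum, coeff_monomial]

theorem vecPoly_coeffVec {d : ℕ} {p : MvPolynomial (Fin n) ℝ} (hp : p.totalDegree ≤ d) :
    vecPoly (coeffVec d p) = p := by
  conv_rhs => rw [p.as_sum]
  rw [vecPoly]
  simp only [coeffVec]
  rw [Finset.sum_coe_sort (expo n d) fun α => monomial α (coeff α p)]
  symm
  refine Finset.sum_subset (fun α hα => mem_expo_of_mem_support hp hα) fun α _ h => ?_
  simp [notMem_support_iff.1 h]

theorem coeffVec_vecPoly {d : ℕ} (u : expo n d → ℝ) : coeffVec d (vecPoly u) = u :=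
  funext fun α => coeff_vecPoly u α

theorem totalDegree_vecPoly_le {d : ℕ} (u : expo n d → ℝ) : (vecPoly u).totalDegree ≤ d :=
  totalDegree_finsetSum_le fun α _ => totalDegree_monomial_le_of_mem α.2 _

theorem vecPoly_ne_zero {d : ℕ} {u : expo n d → ℝ} (hu : u ≠ 0) : vecPoly u ≠ 0 := by
  intro h
  apply hu
  rw [← coeffVec_vecPoly u, h]
  funext α
  simp [coeffVec]

/-- The polynomial `v_d(x)ᵀ Q v_d(x)`. -/
noncomputable def gramPoly {d : ℕ} :
    Matrix (expo n d) (expo n d) ℝ →ₗ[ℝ] MvPolynomial (Fin n) ℝ where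
  toFun Q := ∑ α, ∑ β, monomial (α.1 + β.1) (Q α β)
  map_add' Q R := by simp [Finset.sum_add_distrib]
  map_smul' c Q := by simp [Finset.smul_sum, smul_monomial]

theorem gramPoly_apply {d : ℕ} (Q : Matrix (expo n d) (expo n d) ℝ) :
    gramPoly Q = ∑ α, ∑ β, monomial (α.1 + β.1) (Q α β) := rfl

theorem eval_gramPoly {d : ℕ} (Q : Matrix (expo n d) (expo n d) ℝ) (x : Fin n → ℝ) :
    eval x (gramPoly Q) = gramForm Q x := by
  simp only [gramPoly_apply, map_sum, eval_monomial, gramForm, dotProduct, Matrix.mulVec,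
    monomialVec, Finset.mul_sum]
  refine Finset.sum_congr rfl fun α _ => Finset.sum_congr rfl fun β _ => ?_
  rw [Finsupp.prod_fintype _ _ fun i => pow_zero _]
  simp only [Finsupp.add_apply, pow_add, Finset.prod_mul_distrib]
  ring

theorem totalDegree_gramPoly_le {d : ℕ} (Q : Matrix (expo n d) (expo n d) ℝ) :
    (gramPoly Q).totalDegree ≤ 2 * d := by
  refine totalDegree_finsetSum_le fun α _ => totalDegree_finsetSum_le fun β _ => ?_
  rw [two_mul]
  exact totalDegree_monomial_le_of_mem (add_mem_expo α.2 β.2) _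

theorem gramPoly_vecMulVec {d : ℕ} (u : expo n d → ℝ) :
    gramPoly (Matrix.vecMulVec u u) = vecPoly u * vecPoly u := by
  simp [gramPoly_apply, vecPoly, Finset.sum_mul_sum, monomial_mul, Matrix.vecMulVec_apply]

/-- The bridge between polynomial identities and matrix pairings: localizing is adjoint to `Q ↦ g ·
vᵀ Q v`. -/
theorem rieszLin_mul_gramPoly {d : ℕ} (y : (Fin n →₀ ℕ) → ℝ) (g : MvPolynomial (Fin n) ℝ)
    (Q : Matrix (expo n d) (expo n d) ℝ) :
    rieszLin y (g * gramPoly Q) = (momentMatrix d (mulSeq g y) * Q).trace := by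
  simp only [gramPoly_apply, Finset.mul_sum, map_sum, Matrix.trace, Matrix.diag, Matrix.mul_apply,
    momentMatrix, Matrix.of_apply, mulSeq_eq]
  rw [Finset.sum_comm]
  refine Finset.sum_congr rfl fun α _ => Finset.sum_congr rfl fun β _ => ?_
  have h : monomial (β.1 + α.1) (Q β α) = Q β α • monomial (α.1 + β.1) (1 : ℝ) := by
    rw [smul_monomial, smul_eq_mul, mul_one, add_comm]
  rw [h, mul_smul_comm, map_smul, smul_eq_mul, mul_comm]

theorem dotProduct_momentMatrix {d : ℕ} (y : (Fin n →₀ ℕ) → ℝ) (g : MvPolynomial (Fin n) ℝ)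
    (u : expo n d → ℝ) :
    u ⬝ᵥ (momentMatrix d (mulSeq g y)).mulVec u = rieszLin y (g * (vecPoly u * vecPoly u)) := by
  rw [← gramPoly_vecMulVec, rieszLin_mul_gramPoly, Matrix.mul_vecMulVec, Matrix.trace_vecMulVec,
    dotProduct_comm]

theorem isHermitian_momentMatrix (d : ℕ) (y : (Fin n →₀ ℕ) → ℝ) :
    (momentMatrix d y).IsHermitian := by
  ext α β
  simp [momentMatrix, add_comm]

theorem isSumSq_gramPoly {d : ℕ} {Q : Matrix (expo n d) (expo n d) ℝ} (hQ : Q.PosSemidef) :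
    IsSumSq (gramPoly Q) := by
  obtain ⟨m, v, rfl⟩ := Matrix.posSemidef_iff_eq_sum_vecMulVec.1 hQ
  simp only [star_trivial, map_sum, gramPoly_vecMulVec]
  exact IsSumSq.sum_mul_self _ _

/-- Leading terms do not cancel, so each square has degree at most `2d + 1` and its root at most
`d`. The slack `+ 1` is needed for generators of odd degree, where rounding up in `t_g` loses one.
-/
theorem exists_gramPoly_of_isSumSq {d : ℕ} {σ : MvPolynomial (Fin n) ℝ} (hσ : IsSumSq σ)
    (hd : σ.totalDegree ≤ 2 * d + 1) :
    ∃ Q : Matrix (expo n d) (expo n d) ℝ, Q.PosSemidef ∧ gramPoly Q = σ := by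
  induction hσ with
  | zero => exact ⟨0, Matrix.PosSemidef.zero, map_zero _⟩
  | @sq_add a s hs ih =>
    have ha := leadingCoeff_mul_self_nonneg a
    have hs' := leadingCoeff_nonneg_of_isSumSq hs
    have h1 := (leadingCoeff_add_nonneg ha hs').2
    have h2 := (leadingCoeff_add_nonneg hs' ha).2
    rw [add_comm s] at h2
    obtain ⟨Q, hQ, rfl⟩ := ih (h2.trans hd)
    have hda : a.totalDegree ≤ d := by
      rcases eq_or_ne a 0 with rfl | h0
      · simp
      · rw [totalDegree_mul_of_isDomain h0 h0] at h1
        omega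
    refine ⟨Matrix.vecMulVec (coeffVec d a) (coeffVec d a) + Q, ?_, ?_⟩
    · exact (Matrix.posSemidef_vecMulVec_self_star (coeffVec d a)).add hQ
    · rw [map_add, gramPoly_vecMulVec, vecPoly_coeffVec hda]

/-- Every exponent of degree at most `2t` splits into two exponents of degree at most `t`. -/
theorem exists_add_eq_of_mem_expo {t : ℕ} {γ : Fin n →₀ ℕ} (hγ : γ ∈ expo n (2 * t)) :
    ∃ α ∈ expo n t, ∃ β ∈ expo n t, α + β = γ := by
  rw [mem_expo] at hγ
  -- Climb from `0` towards `γ` one unit at a time, so every intermediate degree occurs below `γ`.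
  have key : ∀ k ≤ ∑ i, γ i, ∃ α ≤ γ, ∑ i, α i = k := by
    intro k
    induction k with
    | zero => exact fun _ => ⟨0, zero_le, by simp⟩
    | succ k ih =>
      intro hk
      obtain ⟨α, hα, rfl⟩ := ih (by omega)
      obtain ⟨i, -, hi⟩ := Finset.exists_lt_of_sum_lt (lt_of_lt_of_le (Nat.lt_succ_self _) hk)
      refine ⟨α + Finsupp.single i 1, fun j => ?_, by simp [Finset.sum_add_distrib]⟩
      have := hα j
      rcases eq_or_ne i j with rfl | h
      · simpa using hi
      · simpa [Finsupp.single_apply, h] using this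
  obtain ⟨α, hα, h⟩ := key (min t (∑ i, γ i)) (min_le_right _ _)
  refine ⟨α, mem_expo.2 (by omega), γ - α, mem_expo.2 ?_, add_tsub_cancel_of_le hα⟩
  have : ∑ i, α i + ∑ i, (γ - α) i = ∑ i, γ i := by
    rw [← Finset.sum_add_distrib]
    exact Finset.sum_congr rfl fun i _ => by simpa using Nat.add_sub_of_le (hα i)
  omega

/-- Symmetric Gram matrices of the polynomials of degree at most `2t` can be chosen continuously. -/
theorem exists_continuous_gram (n t : ℕ) :
    ∃ B : (expo n (2 * t) → ℝ) → Matrix (expo n t) (expo n t) ℝ, Continuous B ∧ B 0 = 0 ∧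
      (∀ v, (B v).IsHermitian) ∧ ∀ v, gramPoly (B v) = vecPoly v := by
  classical
  choose a ha b hb hab using fun γ : expo n (2 * t) => exists_add_eq_of_mem_expo γ.2
  let E : expo n (2 * t) → Matrix (expo n t) (expo n t) ℝ := fun γ =>
    Matrix.single ⟨a γ, ha γ⟩ ⟨b γ, hb γ⟩ 1
  have hE : ∀ γ, gramPoly (E γ) = monomial γ.1 1 ∧ gramPoly (E γ).conjTranspose = monomial γ.1 1 := by
    intro γ
    have h : ∀ i j : expo n t, gramPoly (Matrix.single i j (1 : ℝ)) = monomial (i.1 + j.1) 1 := by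
      intro i j
      rw [gramPoly_apply, Finset.sum_eq_single i, Finset.sum_eq_single j]
      · simp
      · intro k _ hk
        simp [hk.symm]
      · simp
      · intro k _ hk
        simp [hk.symm]
      · simp
    simp only [E, Matrix.conjTranspose_single, star_one, h, hab, true_and]
    rw [add_comm, hab]
  -- `E γ` and its transpose both represent `x^γ`; averaging them gives symmetry, and linearity in
  -- `v` gives continuity.
  refine ⟨fun v => ∑ γ, (v γ / 2) • (E γ + (E γ).conjTranspose), ?_, by simp, fun v => ?_,
    fun v => ?_⟩
  · fun_prop
  · rw [Matrix.IsHermitian, Matrix.conjTranspose_sum]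
    refine Finset.sum_congr rfl fun γ _ => ?_
    rw [Matrix.conjTranspose_smul, Matrix.conjTranspose_add, Matrix.conjTranspose_conjTranspose,
      add_comm, star_trivial]
  · rw [map_sum, vecPoly]
    refine Finset.sum_congr rfl fun γ _ => ?_
    rw [map_smul, map_add, (hE γ).1, (hE γ).2, ← two_smul ℝ, smul_smul, smul_monomial]
    simp

end Pell

/-- Testing the form on `e_i ± e_j` gives `2 |A i j| ≤ A i i + A j j`, and each diagonal entry is at
most the trace. -/
theorem Matrix.PosSemidef.abs_apply_le_trace {ι : Type*} [Fintype ι] {A : Matrix ι ι ℝ}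
    (hA : A.PosSemidef) (i j : ι) : |A i j| ≤ A.trace := by
  classical
  have hd : ∀ k, A k k ≤ A.trace := fun k =>
    Finset.single_le_sum (f := fun k => A k k) (fun l _ => hA.diag_nonneg) (Finset.mem_univ k)
  have key : ∀ c : ℝ, 0 ≤ A i i + c * (A i j + A j i) + c * c * A j j := by
    intro c
    have := hA.dotProduct_mulVec_nonneg (Pi.single i 1 + c • Pi.single j 1)
    simp only [star_trivial, Matrix.mulVec_add, Matrix.mulVec_smul, dotProduct_add, add_dotProduct,
      smul_dotProduct, dotProduct_smul, Matrix.mulVec_single_one, single_one_dotProduct,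
      Matrix.col_apply, smul_eq_mul] at this
    linarith
  have hs : A j i = A i j := by simpa using hA.1.apply i j
  have h1 := key 1
  have h2 := key (-1)
  rw [hs] at h1 h2
  have := hd i
  have := hd j
  rw [abs_le]
  constructor <;> linarith

/-! ### Localizing matrices and the truncated quadratic module. -/

namespace Pell

open MvPolynomial

variable {n t : ℕ} {G : Finset (MvPolynomial (Fin n) ℝ)}

theorem rieszLin_extend_add_smul {d : ℕ} (φ ψ : expo n d → ℝ) (r : ℝ) (p : MvPolynomial (Fin n) ℝ) :
    rieszLin (extend (φ + r • ψ)) p = rieszLin (extend φ) p + r * rieszLin (extend ψ) p := by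
  simp only [rieszLin_extend, Pi.add_apply, Pi.smul_apply, smul_eq_mul, mul_add,
    Finset.sum_add_distrib, Finset.mul_sum, mul_left_comm]

theorem rieszLin_extend_smul_sum {d : ℕ} {κ : Type*} (P : Finset κ) (φ : κ → expo n d → ℝ) (r : ℝ)
    (p : MvPolynomial (Fin n) ℝ) :
    rieszLin (extend (r • ∑ k ∈ P, φ k)) p = r * ∑ k ∈ P, rieszLin (extend (φ k)) p := by
  simp only [rieszLin_extend, Pi.smul_apply, Finset.sum_apply, smul_eq_mul, Finset.mul_sum]
  rw [Finset.sum_comm]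
  exact Finset.sum_congr rfl fun _ _ => Finset.sum_congr rfl fun _ _ => mul_left_comm _ _ _

theorem continuous_rieszLin_extend {d : ℕ} (p : MvPolynomial (Fin n) ℝ) :
    Continuous fun φ : expo n d → ℝ => rieszLin (extend φ) p := by
  simp only [rieszLin_extend]
  fun_prop

theorem locMatrix_apply (φ : expo n (2 * t) → ℝ) (g : MvPolynomial (Fin n) ℝ)
    (α β : expo n (t - halfDeg g)) :
    locMatrix φ g α β = rieszLin (extend φ) (g * monomial (α.1 + β.1) 1) :=
  mulSeq_eq _ _ _

theorem locMatrix_add_smul (φ ψ : expo n (2 * t) → ℝ) (r : ℝ) (g : MvPolynomial (Fin n) ℝ) :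
    locMatrix (φ + r • ψ) g = locMatrix φ g + r • locMatrix ψ g := by
  ext α β
  simp only [Matrix.add_apply, Matrix.smul_apply, locMatrix_apply, rieszLin_extend_add_smul,
    smul_eq_mul]

theorem continuous_locMatrix (t : ℕ) (g : MvPolynomial (Fin n) ℝ) :
    Continuous fun φ : expo n (2 * t) → ℝ => locMatrix φ g := by
  refine continuous_matrix fun α β => ?_
  simp only [locMatrix_apply]
  exact continuous_rieszLin_extend _

theorem isHermitian_locMatrix (φ : expo n (2 * t) → ℝ) (g : MvPolynomial (Fin n) ℝ) :
    (locMatrix φ g).IsHermitian :=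
  isHermitian_momentMatrix _ _

theorem rieszLin_mul_gramPoly_eq_trace (φ : expo n (2 * t) → ℝ) (g : MvPolynomial (Fin n) ℝ)
    (Q : Matrix (expo n (t - halfDeg g)) (expo n (t - halfDeg g)) ℝ) :
    rieszLin (extend φ) (g * gramPoly Q) = (locMatrix φ g * Q).trace :=
  rieszLin_mul_gramPoly _ _ _

theorem halfDeg_one : halfDeg (1 : MvPolynomial (Fin n) ℝ) = 0 := by
  simp [halfDeg]

theorem one_mem_trunc (h1 : 1 ∈ G) : 1 ∈ trunc G t :=
  Finset.mem_filter.2 ⟨h1, by simp [halfDeg_one]⟩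

theorem mem_of_mem_trunc {g : MvPolynomial (Fin n) ℝ} (hg : g ∈ trunc G t) : g ∈ G :=
  (Finset.mem_filter.1 hg).1

theorem totalDegree_add_le_of_mem_trunc {g : MvPolynomial (Fin n) ℝ} (hg : g ∈ trunc G t) :
    g.totalDegree + 2 * (t - halfDeg g) ≤ 2 * t := by
  have := (Finset.mem_filter.1 hg).2
  rw [halfDeg] at *
  omega

theorem totalDegree_mul_gramPoly_le {g : MvPolynomial (Fin n) ℝ} (hg : g ∈ trunc G t)
    (Q : Matrix (expo n (t - halfDeg g)) (expo n (t - halfDeg g)) ℝ) :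
    (g * gramPoly Q).totalDegree ≤ 2 * t :=
  (totalDegree_mul _ _).trans ((Nat.add_le_add_left (totalDegree_gramPoly_le Q) _).trans
    (totalDegree_add_le_of_mem_trunc hg))

/-- Since `g ≠ 0`, degrees add in `σ_g g`; this bounds `deg σ_g` well enough for a Gram matrix of
the prescribed size. -/
theorem mem_quadModule_iff (h0 : ∀ g ∈ G, g ≠ 0) {p : MvPolynomial (Fin n) ℝ} :
    p ∈ quadModule G t ↔ ∃ Q : GramFamily G t, (∀ g, (Q g).PosSemidef) ∧
      p = ∑ g : trunc G t, g.1 * gramPoly (Q g) := by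
  constructor
  · rintro ⟨σ, hσ, rfl⟩
    have hdeg : ∀ g ∈ G, σ g ≠ 0 → (σ g).totalDegree + g.totalDegree ≤ 2 * t := by
      intro g hg hne
      rw [← totalDegree_mul_of_isDomain hne (h0 g hg)]
      exact (hσ g hg).2
    have hgram : ∀ g : trunc G t, ∃ Q : Matrix (expo n (t - halfDeg g.1)) (expo n (t - halfDeg g.1)) ℝ,
        Q.PosSemidef ∧ gramPoly Q = σ g.1 := by
      intro g
      have hg := mem_of_mem_trunc g.2
      refine exists_gramPoly_of_isSumSq (hσ g.1 hg).1 ?_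
      by_cases hne : σ g.1 = 0
      · simp [hne]
      · have := hdeg g.1 hg hne
        rw [halfDeg]
        omega
    choose Q hQ hQσ using hgram
    refine ⟨Q, hQ, ?_⟩
    simp only [hQσ]
    rw [Finset.sum_coe_sort (trunc G t) fun g => g * σ g]
    symm
    simp only [mul_comm _ (σ _)]
    -- Generators outside `G_t` contribute nothing: a nonzero multiplier would force `deg g ≤ 2t`.
    refine Finset.sum_subset (Finset.filter_subset _ _) fun g hg hgt => ?_
    by_contra hne
    have := hdeg g hg (left_ne_zero_of_mul hne)
    refine hgt (Finset.mem_filter.2 ⟨hg, ?_⟩)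
    rw [halfDeg]
    omega
  · rintro ⟨Q, hQ, rfl⟩
    classical
    refine ⟨fun g => if h : g ∈ trunc G t then gramPoly (Q ⟨g, h⟩) else 0, fun g hg => ?_, ?_⟩
    · by_cases h : g ∈ trunc G t
      · simp only [h, dif_pos]
        rw [mul_comm]
        exact ⟨isSumSq_gramPoly (hQ ⟨g, h⟩), totalDegree_mul_gramPoly_le h _⟩
      · simp only [h, dif_neg, not_false_eq_true, zero_mul, totalDegree_zero, zero_le, and_true]
        exact IsSumSq.zero
    · have h : ∑ g : trunc G t, g.1 * gramPoly (Q g) = ∑ g : trunc G t,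
          (if h : g.1 ∈ trunc G t then gramPoly (Q ⟨g.1, h⟩) else 0) * g.1 :=
        Finset.sum_congr rfl fun g _ => by rw [dif_pos g.2, mul_comm]
      rw [h, Finset.sum_coe_sort (trunc G t) fun g =>
        (if h : g ∈ trunc G t then gramPoly (Q ⟨g, h⟩) else 0) * g]
      refine Finset.sum_subset (Finset.filter_subset _ _) fun g _ h => ?_
      have h' : g ∉ trunc G t := h
      rw [dif_neg h', zero_mul]

theorem totalDegree_le_of_mem_quadModule {p : MvPolynomial (Fin n) ℝ} (hp : p ∈ quadModule G t) :
    p.totalDegree ≤ 2 * t := by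
  obtain ⟨σ, hσ, rfl⟩ := hp
  exact totalDegree_finsetSum_le fun g hg => (hσ g hg).2

/-! ### The primal feasible set: compactness and strict feasibility. -/

/-- If `1` is interior to the truncated quadratic module, then the trace of the moment matrix is
bounded on the primal feasible set. -/
theorem exists_trace_le (h1 : 1 ∈ G) (h0 : ∀ g ∈ G, g ≠ 0) (hint : OneMemInterior G t) :
    ∃ C : ℝ, ∀ φ, PrimalFeasible G t φ → (locMatrix φ 1).trace ≤ C := by
  -- `I = ∑ x^(2α)` over `|α| ≤ t`, so that `φ(I)` is the trace of the moment matrix.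
  set I : MvPolynomial (Fin n) ℝ :=
    gramPoly (1 : Matrix (expo n (t - halfDeg (1 : MvPolynomial (Fin n) ℝ))) _ ℝ) with hI
  have hcont : Continuous fun r : ℝ => coeffVec (2 * t) 1 - r • coeffVec (2 * t) I := by fun_prop
  have hev := (hcont.tendsto' 0 (coeffVec (2 * t) 1) (by simp)).eventually
    (mem_interior_iff_mem_nhds.1 hint)
  obtain ⟨r, ⟨p, hp, hpr⟩, hr⟩ := ((hev.filter_mono nhdsWithin_le_nhds).and
    (self_mem_nhdsWithin : Set.Ioi (0 : ℝ) ∈ nhdsWithin 0 (Set.Ioi 0))).exists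
  have hIdeg : I.totalDegree ≤ 2 * t := by
    have := totalDegree_mul_gramPoly_le (one_mem_trunc (t := t) h1)
      (1 : Matrix (expo n (t - halfDeg (1 : MvPolynomial (Fin n) ℝ))) _ ℝ)
    rwa [one_mul] at this
  have hdeg : (1 - r • I).totalDegree ≤ 2 * t :=
    (totalDegree_sub _ _).trans (max_le (by simp) ((totalDegree_smul_le _ _).trans hIdeg))
  have hpI : p = 1 - r • I := by
    rw [← vecPoly_coeffVec (totalDegree_le_of_mem_quadModule hp), ← vecPoly_coeffVec hdeg, hpr]
    congr 1
  obtain ⟨Q, hQ, hpQ⟩ := (mem_quadModule_iff h0).1 hp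
  refine ⟨r⁻¹, fun φ hφ => ?_⟩
  -- A feasible `φ` is nonnegative on the quadratic module; at `p = 1 - r I` this reads `r · tr
  -- M_t(φ) ≤ 1`.
  have hpos : 0 ≤ rieszLin (extend φ) p := by
    rw [hpQ, map_sum]
    refine Finset.sum_nonneg fun g _ => ?_
    rw [rieszLin_mul_gramPoly_eq_trace]
    exact (hφ.2 g.1 g.2).trace_mul_nonneg (hQ g)
  have hItr : rieszLin (extend φ) I = (locMatrix φ 1).trace := by
    rw [hI, ← one_mul (gramPoly _), rieszLin_mul_gramPoly_eq_trace, Matrix.mul_one]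
  rw [hpI, map_sub, map_smul, hItr, rieszLin_apply, hφ.1, smul_eq_mul] at hpos
  rw [← one_div, le_div_iff₀' hr]
  linarith

/-- Every `φ_γ` is an entry of the moment matrix, hence bounded by its trace. -/
theorem isCompact_primalFeasible (h1 : 1 ∈ G) (h0 : ∀ g ∈ G, g ≠ 0) (hint : OneMemInterior G t) :
    IsCompact {φ | PrimalFeasible G t φ} := by
  obtain ⟨C, hC⟩ := exists_trace_le h1 h0 hint
  refine Metric.isCompact_of_isClosed_isBounded ?_ ?_
  · simp only [PrimalFeasible, ← rieszLin_apply, Set.ofPred_and, Set.ofPred_forall]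
    refine (isClosed_eq (continuous_rieszLin_extend _) continuous_const).inter
      (isClosed_biInter fun g _ => ?_)
    exact Matrix.isClosed_setOf_posSemidef.preimage (continuous_locMatrix t g)
  · refine (Metric.isBounded_closedBall (x := (0 : expo n (2 * t) → ℝ)) (r := max C 0)).subset
      fun φ hφ => ?_
    rw [mem_closedBall_zero_iff, pi_norm_le_iff_of_nonneg (le_max_right _ _)]
    intro γ
    obtain ⟨α, hα, β, hβ, hab⟩ := exists_add_eq_of_mem_expo γ.2
    have hd : t = t - halfDeg (1 : MvPolynomial (Fin n) ℝ) := by simp [halfDeg_one]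
    have h := ((hφ.2 1 (one_mem_trunc h1)).abs_apply_le_trace ⟨α, hd ▸ hα⟩ ⟨β, hd ▸ hβ⟩).trans
      (hC φ hφ)
    rw [locMatrix_apply, one_mul, rieszLin_monomial, one_mul, hab] at h
    refine le_max_of_le_left ?_
    simpa [extend, γ.2] using h

theorem PrimalFeasible.rieszLin_one {φ : expo n (2 * t) → ℝ} (hφ : PrimalFeasible G t φ) :
    rieszLin (extend φ) 1 = 1 := by
  rw [rieszLin_apply, hφ.1]

/-- A point mass average over a fine grid is strictly feasible in the primal problem. -/
theorem exists_posDef_primalFeasible (h0 : ∀ g ∈ G, g ≠ 0) {x₀ : Fin n → ℝ} {ε : ℝ} (hε : 0 < ε)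
    (hpos : ∀ x ∈ Metric.ball x₀ ε, ∀ g ∈ G, 0 ≤ eval x g) :
    ∃ φ, PrimalFeasible G t φ ∧ ∀ g ∈ trunc G t, (locMatrix φ g).PosDef := by
  classical
  -- With `2t + 1` nodes per coordinate, no nonzero polynomial of degree at most `2t` vanishes on
  -- the whole grid.
  have hS : ∀ i, ∃ S : Finset ℝ, (S : Set ℝ) ⊆ Metric.ball (x₀ i) ε ∧ S.card = 2 * t + 1 := by
    intro i
    rw [Real.ball_eq_Ioo]
    exact (Set.Ioo_infinite (by linarith)).exists_subset_card_eq _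
  choose S hSball hScard using hS
  set P := Fintype.piFinset S with hP
  have hPball : ∀ x ∈ P, x ∈ Metric.ball x₀ ε := by
    intro x hx
    rw [Metric.mem_ball, dist_pi_lt_iff hε]
    exact fun i => hSball i (Fintype.mem_piFinset.1 hx i)
  have hcard : 0 < (P.card : ℝ) := by
    rw [Nat.cast_pos, hP, Fintype.card_piFinset]
    exact Finset.prod_pos fun i _ => by rw [hScard]; omega
  set φ : expo n (2 * t) → ℝ := (P.card : ℝ)⁻¹ • ∑ x ∈ P, dirac (2 * t) x with hφ
  have heval : ∀ p : MvPolynomial (Fin n) ℝ, p.totalDegree ≤ 2 * t →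
      rieszLin (extend φ) p = (P.card : ℝ)⁻¹ * ∑ x ∈ P, eval x p := by
    intro p hp
    rw [hφ, rieszLin_extend_smul_sum]
    simp only [rieszLin_dirac _ hp]
  have hpd : ∀ g ∈ trunc G t, (locMatrix φ g).PosDef := by
    intro g hg
    have hdeg := totalDegree_add_le_of_mem_trunc hg
    refine Matrix.PosDef.of_dotProduct_mulVec_pos (isHermitian_locMatrix _ _) fun u hu => ?_
    have hq := totalDegree_vecPoly_le u
    have hq0 := vecPoly_ne_zero hu
    rw [star_trivial, locMatrix, dotProduct_momentMatrix, heval]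
    · refine mul_pos (inv_pos.2 hcard) ?_
      have hterm : ∀ x ∈ P, 0 ≤ eval x (g * (vecPoly u * vecPoly u)) := by
        intro x hx
        rw [map_mul, map_mul]
        exact mul_nonneg (hpos x (hPball x hx) g (mem_of_mem_trunc hg)) (mul_self_nonneg _)
      refine (Finset.sum_nonneg hterm).lt_of_ne fun hzero => ?_
      have hz := (Finset.sum_eq_zero_iff_of_nonneg hterm).1 hzero.symm
      -- If `g q²` vanishes on the grid, so does `g q`, whose degree is at most `2t`.
      refine mul_ne_zero (h0 g (mem_of_mem_trunc hg)) hq0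
        (eq_zero_of_eval_zero_at_prod_finset _ S (fun i => ?_) fun x hx => ?_)
      · rw [hScard]
        have h1 := degreeOf_le_totalDegree (g * vecPoly u) i
        have h2 := totalDegree_mul g (vecPoly u)
        omega
      · have := hz x (Fintype.mem_piFinset.2 hx)
        rw [map_mul, map_mul] at this
        rw [map_mul]
        rcases mul_eq_zero.1 this with h | h
        · rw [h, zero_mul]
        · rw [mul_self_eq_zero.1 h, mul_zero]
    · have h1 := totalDegree_mul g (vecPoly u * vecPoly u)
      have h2 := totalDegree_mul (vecPoly u) (vecPoly u)
      omega
  refine ⟨φ, ⟨?_, fun g hg => (hpd g hg).posSemidef⟩, hpd⟩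
  rw [← rieszLin_apply, heval 1 (by simp)]
  simp [hcard.ne']

/-! ### Weak duality, first-order conditions, and the converse. -/

theorem totalSize_eq (G : Finset (MvPolynomial (Fin n) ℝ)) (t : ℕ) :
    totalSize G t = ∑ g : trunc G t, (Fintype.card (expo n (t - halfDeg g.1)) : ℝ) := by
  simp only [card_expo]
  rw [totalSize, ← Finset.sum_coe_sort]

theorem totalSize_pos (h1 : 1 ∈ G) : 0 < totalSize G t := by
  refine Finset.sum_pos (fun g _ => ?_) ⟨1, one_mem_trunc h1⟩
  exact_mod_cast Nat.choose_pos (Nat.le_add_right _ _)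

theorem dualFeasible_iff {Q : GramFamily G t} :
    DualFeasible G t Q ↔ (∀ g, (Q g).PosSemidef) ∧
      ∑ g : trunc G t, g.1 * gramPoly (Q g) = C (totalSize G t) := by
  refine and_congr_right fun _ => ⟨fun h => MvPolynomial.funext fun x => ?_, fun h x => ?_⟩
  · rw [eval_C, h x, map_sum]
    simp [eval_gramPoly]
  · have := congrArg (eval x) h
    rw [eval_C, map_sum] at this
    rw [← this]
    simp [eval_gramPoly]

theorem DualFeasible.sum_trace {Q : GramFamily G t} (hQ : DualFeasible G t Q)
    {φ : expo n (2 * t) → ℝ} (hφ : PrimalFeasible G t φ) :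
    ∑ g : trunc G t, (locMatrix φ g.1 * Q g).trace = totalSize G t := by
  have h := congrArg (rieszLin (extend φ)) (dualFeasible_iff.1 hQ).2
  rw [map_sum, C_eq_smul_one, map_smul, hφ.rieszLin_one, smul_eq_mul, mul_one] at h
  simpa only [rieszLin_mul_gramPoly_eq_trace] using h

/-- Weak duality, together with its equality case. -/
theorem sum_log_det_add_le {φ : expo n (2 * t) → ℝ} (hφ : PrimalFeasible G t φ)
    (hpd : ∀ g : trunc G t, (locMatrix φ g.1).PosDef) {Q : GramFamily G t}
    (hQ : DualFeasible G t Q) (hQpd : ∀ g, (Q g).PosDef) :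
    ∑ g : trunc G t, Real.log (locMatrix φ g.1).det + ∑ g, Real.log (Q g).det ≤ 0 ∧
      (∑ g : trunc G t, Real.log (locMatrix φ g.1).det + ∑ g, Real.log (Q g).det = 0 →
        ∀ g, Q g = (locMatrix φ g.1)⁻¹) := by
  have hle := fun g => (hpd g).log_det_add_log_det (hQpd g)
  have hsum : ∑ g : trunc G t, ((locMatrix φ g.1 * Q g).trace -
      Fintype.card (expo n (t - halfDeg g.1))) = 0 := by
    rw [Finset.sum_sub_distrib, hQ.sum_trace hφ, totalSize_eq, sub_self]
  rw [← Finset.sum_add_distrib, ← hsum]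
  refine ⟨Finset.sum_le_sum fun g _ => (hle g).1, fun h g => (hle g).2 ?_⟩
  exact (Finset.sum_eq_sum_iff_of_le fun g _ => (hle g).1).1 h g (Finset.mem_univ g)

/-- The family of the inverses of the localizing matrices of `φ`. -/
noncomputable def invFamily (G : Finset (MvPolynomial (Fin n) ℝ)) (φ : expo n (2 * t) → ℝ) :
    GramFamily G t :=
  fun g => (locMatrix φ g.1)⁻¹

/-- First-order optimality: the inverses of the localizing matrices of a maximizer of the
determinant are dual feasible. -/
theorem exists_dualFeasible_inv (h1 : 1 ∈ G) (h0 : ∀ g ∈ G, g ≠ 0) (hint : OneMemInterior G t)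
    (hstrict : ∃ φ, PrimalFeasible G t φ ∧ ∀ g ∈ trunc G t, (locMatrix φ g).PosDef) :
    ∃ φ, PrimalFeasible G t φ ∧ (∀ g : trunc G t, (locMatrix φ g.1).PosDef) ∧
      DualFeasible G t (invFamily G φ) := by
  classical
  obtain ⟨φ₀, hφ₀, hpd₀⟩ := hstrict
  -- Unlike the sum of logarithms, the product of determinants is real and continuous even at
  -- singular blocks.
  set F : (expo n (2 * t) → ℝ) → ℝ := fun φ => ∏ g : trunc G t, (locMatrix φ g.1).det with hF
  have hFc : Continuous F :=
    continuous_finsetProd _ fun g _ => (continuous_locMatrix t g.1).matrix_det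
  obtain ⟨φ, hφ, hmax⟩ := (isCompact_primalFeasible h1 h0 hint).exists_isMaxOn ⟨φ₀, hφ₀⟩
    hFc.continuousOn
  have hφ' : PrimalFeasible G t φ := hφ
  have hFpos : 0 < F φ :=
    lt_of_lt_of_le (Finset.prod_pos fun g _ => (hpd₀ g.1 g.2).det_pos) (hmax hφ₀)
  have hpd : ∀ g : trunc G t, (locMatrix φ g.1).PosDef := fun g =>
    (hφ'.2 g.1 g.2).posDef_iff_det_ne_zero.2
      (Finset.prod_ne_zero_iff.1 hFpos.ne' g (Finset.mem_univ g))
  -- Positive definiteness is open, so `φ + r ψ` stays feasible for small `r` of either sign, and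
  -- the derivative of `F` vanishes.
  have hcrit : ∀ ψ : expo n (2 * t) → ℝ, rieszLin (extend ψ) 1 = 0 →
      ∑ g : trunc G t, ((locMatrix φ g.1)⁻¹ * locMatrix ψ g.1).trace = 0 := by
    intro ψ hψ
    have hev : ∀ᶠ r : ℝ in nhds 0, ∀ g : trunc G t,
        (locMatrix φ g.1 + r • locMatrix ψ g.1).PosDef := by
      refine Filter.eventually_all.2 fun g => Matrix.eventually_posDef (by fun_prop) (fun r => ?_)
        (by simpa using hpd g)
      rw [← locMatrix_add_smul]
      exact isHermitian_locMatrix _ _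
    have hloc : IsLocalMax (fun r : ℝ => ∏ g : trunc G t,
        (locMatrix φ g.1 + r • locMatrix ψ g.1).det) 0 := by
      filter_upwards [hev] with r hr
      have hfeas : PrimalFeasible G t (φ + r • ψ) := by
        refine ⟨?_, fun g hg => ?_⟩
        · rw [← rieszLin_apply, rieszLin_extend_add_smul, hφ'.rieszLin_one, hψ, mul_zero, add_zero]
        · rw [locMatrix_add_smul]
          exact (hr ⟨g, hg⟩).posSemidef
      have := hmax hfeas
      simpa [hF, locMatrix_add_smul] using this
    have hder := HasDerivAt.fun_finsetProd (u := Finset.univ) fun (g : trunc G t) _ =>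
      Matrix.hasDerivAt_det_add_smul (hpd g) (locMatrix ψ g.1)
    have hzero := hloc.hasDerivAt_eq_zero hder
    simp only [zero_smul, add_zero, smul_eq_mul, ← mul_assoc] at hzero
    have hprod : ∀ g : trunc G t, (∏ j ∈ Finset.univ.erase g, (locMatrix φ j.1).det) *
        (locMatrix φ g.1).det = F φ := fun g => Finset.prod_erase_mul _ _ (Finset.mem_univ g)
    simp only [hprod, ← Finset.mul_sum] at hzero
    exact (mul_eq_zero.1 hzero).resolve_left hFpos.ne'
  have hself : ∑ g : trunc G t, ((locMatrix φ g.1)⁻¹ * locMatrix φ g.1).trace = totalSize G t := by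
    rw [totalSize_eq]
    refine Finset.sum_congr rfl fun g _ => ?_
    rw [Matrix.nonsing_inv_mul _ ((Matrix.isUnit_iff_isUnit_det _).1 (hpd g).isUnit),
      Matrix.trace_one]
  refine ⟨φ, hφ', hpd, fun g => (hpd g).inv.posSemidef, fun x => ?_⟩
  have hone : rieszLin (extend (dirac (2 * t) x)) 1 = 1 := by
    rw [rieszLin_dirac x (by simp), map_one]
  -- In the direction `δ_x - φ`, the `φ` part contributes `-N`, and the Dirac part is the right side
  -- of the dual identity at `x`.
  have h := hcrit (dirac (2 * t) x + (-1 : ℝ) • φ) (by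
    rw [rieszLin_extend_add_smul, hone, hφ'.rieszLin_one]; norm_num)
  simp only [locMatrix_add_smul, Matrix.mul_add, Matrix.trace_add, Finset.sum_add_distrib,
    Matrix.mul_smul, Matrix.trace_smul, ← Finset.smul_sum, hself] at h
  have hx : ∑ g : trunc G t, ((locMatrix φ g.1)⁻¹ * locMatrix (dirac (2 * t) x) g.1).trace =
      totalSize G t := by
    rw [smul_eq_mul] at h
    linarith
  rw [← hx]
  refine Finset.sum_congr rfl fun g _ => ?_
  rw [Matrix.trace_mul_comm, ← rieszLin_mul_gramPoly_eq_trace,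
    rieszLin_dirac x (totalDegree_mul_gramPoly_le g.2 _), map_mul, eval_gramPoly]
  rfl

/-- A strictly feasible dual family puts `1` in the interior of the quadratic module. -/
theorem oneMemInterior_of_dualFeasible (h1 : 1 ∈ G) (h0 : ∀ g ∈ G, g ≠ 0) {Q : GramFamily G t}
    (hQ : DualFeasible G t Q) (hpd : ∀ g, (Q g).PosDef) : OneMemInterior G t := by
  classical
  have hN := totalSize_pos (t := t) h1
  have hB : ∃ B : (expo n (2 * t) → ℝ) →
      Matrix (expo n (t - halfDeg (1 : MvPolynomial (Fin n) ℝ)))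
        (expo n (t - halfDeg (1 : MvPolynomial (Fin n) ℝ))) ℝ, Continuous B ∧ B 0 = 0 ∧
      (∀ v, (B v).IsHermitian) ∧ ∀ v, gramPoly (B v) = vecPoly v := by
    rw [halfDeg_one, Nat.sub_zero]
    exact exists_continuous_gram n t
  obtain ⟨B, hBc, hB0, hBh, hBg⟩ := hB
  let o : trunc G t := ⟨1, one_mem_trunc h1⟩
  let B' : (expo n (2 * t) → ℝ) → Matrix (expo n (t - halfDeg o.1)) (expo n (t - halfDeg o.1)) ℝ := B
  have hNQ : ∀ g, ((totalSize G t)⁻¹ • Q g).PosDef := fun g => (hpd g).smul (inv_pos.2 hN)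
  -- Dividing by `N` represents `1` itself; a Gram matrix of the difference from `1`, small near
  -- `1`, is absorbed by the block of `g = 1`.
  have hev : ∀ᶠ v in nhds (coeffVec (2 * t) (1 : MvPolynomial (Fin n) ℝ)),
      ((totalSize G t)⁻¹ • Q o + B' (v - coeffVec (2 * t) 1)).PosDef := by
    refine Matrix.eventually_posDef ?_ (fun v => (hNQ o).1.add (hBh _)) ?_
    · exact continuous_const.add (hBc.comp (continuous_id.sub continuous_const))
    · have : B' (coeffVec (2 * t) 1 - coeffVec (2 * t) 1) = 0 := by rw [sub_self]; exact hB0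
      rw [this, add_zero]
      exact hNQ o
  refine mem_interior_iff_mem_nhds.2 ?_
  filter_upwards [hev] with v hv
  refine ⟨vecPoly v, (mem_quadModule_iff h0).2
    ⟨fun g => (totalSize G t)⁻¹ • Q g + (Pi.single o (B' (v - coeffVec (2 * t) 1)) : GramFamily G t) g,
      fun g => ?_, ?_⟩, coeffVec_vecPoly v⟩
  · by_cases hg : g = o
    · subst hg
      simpa using hv.posSemidef
    · simpa [Pi.single_eq_of_ne hg] using (hNQ g).posSemidef
  · simp only [map_add, mul_add, Finset.sum_add_distrib, map_smul, mul_smul_comm,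
      ← Finset.smul_sum, (dualFeasible_iff.1 hQ).2]
    rw [Finset.sum_eq_single o (fun g _ hg => by simp [Pi.single_eq_of_ne hg]) (by simp),
      Pi.single_eq_same, one_mul]
    have h2 : gramPoly (B' (v - coeffVec (2 * t) 1)) = vecPoly v - 1 := by
      refine (hBg _).trans ?_
      conv_rhs => rw [← vecPoly_coeffVec (d := 2 * t) (p := (1 : MvPolynomial (Fin n) ℝ)) (by simp)]
      simp [vecPoly]
    rw [h2, smul_eq_C_mul, ← C_mul, inv_mul_cancel₀ hN.ne', C_1]
    ring

end Pell

/-! ### Extended-real objectives and optimality. -/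

namespace Pell

open MvPolynomial

theorem sum_logDet_of_posDef {κ : Type*} {ι : κ → Type*} [∀ k, Fintype (ι k)]
    [∀ k, DecidableEq (ι k)] (P : Finset κ) {A : (k : κ) → Matrix (ι k) (ι k) ℝ}
    (hA : ∀ k, (A k).PosDef) :
    ∑ k ∈ P, logDet (A k) = ((∑ k ∈ P, Real.log (A k).det : ℝ) : EReal) := by
  classical
  induction P using Finset.induction_on with
  | empty => simp
  | insert k P hk ih =>
    rw [Finset.sum_insert hk, Finset.sum_insert hk, EReal.coe_add, ih, logDet, if_pos (hA k)]

/-- `⊥` is absorbing for addition in `EReal`, so one block that is not positive definite decides the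
sum. -/
theorem sum_logDet_eq_bot {κ : Type*} {ι : κ → Type*} [∀ k, Fintype (ι k)]
    [∀ k, DecidableEq (ι k)] {P : Finset κ} {A : (k : κ) → Matrix (ι k) (ι k) ℝ} {k : κ}
    (hk : k ∈ P) (hA : ¬ (A k).PosDef) : ∑ k ∈ P, logDet (A k) = ⊥ := by
  classical
  rw [← Finset.add_sum_erase _ _ hk, logDet, if_neg hA, EReal.bot_add]

variable {n t : ℕ} {G : Finset (MvPolynomial (Fin n) ℝ)}

theorem primalObj_eq_sum_coe (φ : expo n (2 * t) → ℝ) :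
    primalObj G t φ = -∑ g : trunc G t, logDet (locMatrix φ g.1) := by
  rw [primalObj, ← Finset.sum_coe_sort]

theorem primalObj_of_posDef {φ : expo n (2 * t) → ℝ}
    (hpd : ∀ g : trunc G t, (locMatrix φ g.1).PosDef) :
    primalObj G t φ = ((-∑ g : trunc G t, Real.log (locMatrix φ g.1).det : ℝ) : EReal) := by
  rw [primalObj_eq_sum_coe, sum_logDet_of_posDef _ hpd, EReal.coe_neg]

theorem posDef_of_primalObj_ne_top {φ : expo n (2 * t) → ℝ} (h : primalObj G t φ ≠ ⊤)
    (g : trunc G t) : (locMatrix φ g.1).PosDef := by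
  by_contra hg
  refine h ?_
  rw [primalObj_eq_sum_coe, sum_logDet_eq_bot (Finset.mem_univ g) hg, EReal.neg_bot]

theorem dualObj_of_posDef {Q : GramFamily G t} (hpd : ∀ g, (Q g).PosDef) :
    dualObj G t Q = ((∑ g, Real.log (Q g).det : ℝ) : EReal) :=
  sum_logDet_of_posDef _ hpd

theorem posDef_of_dualObj_ne_bot {Q : GramFamily G t} (h : dualObj G t Q ≠ ⊥) (g : trunc G t) :
    (Q g).PosDef := by
  by_contra hg
  exact h (sum_logDet_eq_bot (Finset.mem_univ g) hg)

theorem dualObj_le_primalObj {φ : expo n (2 * t) → ℝ} (hφ : PrimalFeasible G t φ)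
    {Q : GramFamily G t} (hQ : DualFeasible G t Q) : dualObj G t Q ≤ primalObj G t φ := by
  by_cases hp : primalObj G t φ = ⊤
  · rw [hp]
    exact le_top
  by_cases hd : dualObj G t Q = ⊥
  · rw [hd]
    exact bot_le
  have hpd := posDef_of_primalObj_ne_top hp
  have hQpd := posDef_of_dualObj_ne_bot hd
  rw [primalObj_of_posDef hpd, dualObj_of_posDef hQpd, EReal.coe_le_coe_iff]
  have := (sum_log_det_add_le hφ hpd hQ hQpd).1
  linarith

theorem dualValue_le_primalValue (G : Finset (MvPolynomial (Fin n) ℝ)) (t : ℕ) :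
    dualValue G t ≤ primalValue G t :=
  iSup₂_le fun _ hQ => le_iInf₂ fun _ hφ => dualObj_le_primalObj hφ hQ

/-- A primal feasible point whose inverse localizing matrices are dual feasible solves both
problems, and there is no other solution. -/
theorem optimal_of_dualFeasible_inv {φ : expo n (2 * t) → ℝ} (h1 : 1 ∈ G)
    (hφ : PrimalFeasible G t φ) (hpd : ∀ g : trunc G t, (locMatrix φ g.1).PosDef)
    (hQ : DualFeasible G t (invFamily G φ)) :
    (primalValue G t = primalObj G t φ ∧ dualValue G t = primalObj G t φ) ∧
      (PrimalOptimal G t φ ∧ ∀ ψ, PrimalOptimal G t ψ → ψ = φ) ∧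
      (DualOptimal G t (invFamily G φ) ∧ ∀ R, DualOptimal G t R → R = invFamily G φ) := by
  have hQpd : ∀ g, (invFamily G φ g).PosDef := fun g => (hpd g).inv
  have hobj : dualObj G t (invFamily G φ) = primalObj G t φ := by
    rw [primalObj_of_posDef hpd, dualObj_of_posDef hQpd]
    simp [invFamily, Matrix.det_nonsing_inv, Ring.inverse_eq_inv', Real.log_inv]
  have hple : primalValue G t ≤ primalObj G t φ := iInf_le_of_le φ (iInf_le_of_le hφ le_rfl)
  have hdle : primalObj G t φ ≤ dualValue G t := by
    rw [← hobj, dualValue]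
    exact le_iSup_of_le _ (le_iSup_of_le hQ le_rfl)
  have hpd_le := dualValue_le_primalValue G t
  have hpv : primalValue G t = primalObj G t φ := le_antisymm hple (hdle.trans hpd_le)
  have hdv : dualValue G t = primalObj G t φ := le_antisymm (hpd_le.trans hple) hdle
  have hreal := primalObj_of_posDef hpd
  refine ⟨⟨hpv, hdv⟩, ⟨⟨hφ, hpv.symm⟩, fun ψ hψ => ?_⟩, ⟨hQ, hobj.trans hdv.symm⟩, fun R hR => ?_⟩
  · have hψobj := hψ.2.trans hpv
    have hψpd := posDef_of_primalObj_ne_top (φ := ψ) (by rw [hψobj, hreal]; exact EReal.coe_ne_top _)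
    have hsum : ∑ g : trunc G t, Real.log (locMatrix ψ g.1).det +
        ∑ g : trunc G t, Real.log (invFamily G φ g).det = 0 := by
      have h := hψobj.trans hobj.symm
      rw [primalObj_of_posDef hψpd, dualObj_of_posDef hQpd, EReal.coe_eq_coe_iff] at h
      linarith
    -- Equality in weak duality against the same dual family forces equal inverses; the block `g =
    -- 1` already contains every entry of `ψ`.
    have heq := (sum_log_det_add_le hψ.1 hψpd hQ hQpd).2 hsum ⟨1, one_mem_trunc h1⟩
    have hM : locMatrix ψ 1 = locMatrix φ 1 :=
      (Matrix.inv_inj heq ((Matrix.isUnit_iff_isUnit_det _).1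
        (hpd ⟨1, one_mem_trunc h1⟩).isUnit)).symm
    funext γ
    obtain ⟨α, hα, β, hβ, hab⟩ := exists_add_eq_of_mem_expo γ.2
    have hd : t = t - halfDeg (1 : MvPolynomial (Fin n) ℝ) := by simp [halfDeg_one]
    have h := congrFun (congrFun hM ⟨α, hd ▸ hα⟩) ⟨β, hd ▸ hβ⟩
    simp only [locMatrix_apply, one_mul, rieszLin_monomial, hab] at h
    simpa [extend, γ.2] using h
  · have hRobj := hR.2.trans hdv
    have hRpd := posDef_of_dualObj_ne_bot (Q := R) (by rw [hRobj, hreal]; exact EReal.coe_ne_bot _)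
    funext g
    refine (sum_log_det_add_le hφ hpd hR.1 hRpd).2 ?_ g
    rw [dualObj_of_posDef hRpd, hreal, EReal.coe_eq_coe_iff] at hRobj
    linarith

theorem gens_nonneg_on_ball {m : ℕ} {g : Fin m → MvPolynomial (Fin n) ℝ}
    (hS : (interior (basicSet g)).Nonempty) :
    ∃ x₀ : Fin n → ℝ, ∃ ε > 0, ∀ x ∈ Metric.ball x₀ ε, ∀ p ∈ gens g, 0 ≤ eval x p := by
  obtain ⟨x₀, hx₀⟩ := hS
  obtain ⟨ε, hε, hball⟩ := Metric.mem_nhds_iff.1 (mem_interior_iff_mem_nhds.1 hx₀)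
  refine ⟨x₀, ε, hε, fun x hx p hp => ?_⟩
  rcases Finset.mem_insert.1 hp with rfl | hp
  · simp
  · obtain ⟨j, -, rfl⟩ := Finset.mem_image.1 hp
    exact hball hx j

end Pell

open Pell

theorem theorem2p6 {n m : ℕ} (g : Fin m → MvPolynomial (Fin n) ℝ) (hg : ∀ j, g j ≠ 0)
    (hS : (interior (basicSet g)).Nonempty) (t : ℕ) :
    ((∃ r : ℝ, primalValue (gens g) t = (r : EReal) ∧ dualValue (gens g) t = (r : EReal)) ↔
        OneMemInterior (gens g) t) ∧
    (OneMemInterior (gens g) t →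
      ∃ (φ : expo n (2 * t) → ℝ) (Q : GramFamily (gens g) t),
        (PrimalOptimal (gens g) t φ ∧ ∀ ψ, PrimalOptimal (gens g) t ψ → ψ = φ) ∧
        (DualOptimal (gens g) t Q ∧ ∀ R, DualOptimal (gens g) t R → R = Q) ∧
        (∀ h : trunc (gens g) t, (locMatrix φ h.1).PosDef ∧ Q h = (locMatrix φ h.1)⁻¹) ∧
        (∀ x : Fin n → ℝ,
          1 = 1 / totalSize (gens g) t *
            ∑ h ∈ trunc (gens g) t, MvPolynomial.eval x h * gramForm (locMatrix φ h)⁻¹ x) ∧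
        (∀ x : Fin n → ℝ,
          totalSize (gens g) t =
            ∑ h ∈ trunc (gens g) t, MvPolynomial.eval x h *
              (christoffel (t - halfDeg h) (mulSeq h (extend φ)) x)⁻¹)) := by
  have h1 : 1 ∈ gens g := Finset.mem_insert_self _ _
  have h0 : ∀ p ∈ gens g, p ≠ 0 := by
    intro p hp
    rcases Finset.mem_insert.1 hp with rfl | hp
    · exact one_ne_zero
    · obtain ⟨j, -, rfl⟩ := Finset.mem_image.1 hp
      exact hg j
  obtain ⟨x₀, ε, hε, hball⟩ := gens_nonneg_on_ball hS
  have hstrict := exists_posDef_primalFeasible (t := t) h0 hε hball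
  refine ⟨⟨?_, fun hint => ?_⟩, fun hint => ?_⟩
  · rintro ⟨r, -, hr⟩
    by_contra hint
    -- If `1` is not interior, every dual feasible family has a block that is not positive definite,
    -- hence objective `⊥`.
    have hbot : dualValue (gens g) t ≤ ⊥ := iSup₂_le fun Q hQ => by
      by_contra hne
      exact hint (oneMemInterior_of_dualFeasible h1 h0 hQ
        (posDef_of_dualObj_ne_bot fun h => hne h.le))
    exact EReal.coe_ne_bot r (hr ▸ le_bot_iff.1 hbot)
  · obtain ⟨φ, hφ, hpd, hQ⟩ := exists_dualFeasible_inv h1 h0 hint hstrict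
    have hopt := (optimal_of_dualFeasible_inv h1 hφ hpd hQ).1
    exact ⟨_, hopt.1.trans (primalObj_of_posDef hpd), hopt.2.trans (primalObj_of_posDef hpd)⟩
  · obtain ⟨φ, hφ, hpd, hQ⟩ := exists_dualFeasible_inv h1 h0 hint hstrict
    obtain ⟨-, hprimal, hdual⟩ := optimal_of_dualFeasible_inv h1 hφ hpd hQ
    have hid : ∀ x : Fin n → ℝ, totalSize (gens g) t =
        ∑ h ∈ trunc (gens g) t, MvPolynomial.eval x h * gramForm (locMatrix φ h)⁻¹ x :=
      fun x => (hQ.2 x).trans (Finset.sum_coe_sort (trunc (gens g) t) fun h =>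
        MvPolynomial.eval x h * gramForm (locMatrix φ h)⁻¹ x)
    refine ⟨φ, _, hprimal, hdual, fun h => ⟨hpd h, rfl⟩, fun x => ?_, fun x => ?_⟩
    · rw [← hid x, one_div_mul_cancel (totalSize_pos h1).ne']
    · simp only [christoffel, inv_inv]
      exact hid x
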